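/- Let $M$ be a smooth manifold of dimension $2n+1$ with an almost contact complex Riemannian (B-metric) structure $(\varphi,\xi,\eta,g)$: smooth tensor fields with $\varphi\xi=0$, $\varphi^2=-\mathrm{Id}+\eta\otimes\xi$, $\eta\circ\varphi=0$, $\eta(\xi)=1$, where $g$ is a pseudo-Riemannian metric of signature $(n+1,n)$ with $g(\varphi x,\varphi y)=-g(x,y)+\eta(x)\eta(y)$. Let $\nabla$ be the Levi-Civita connection of $g$, $F(x,y,z)=g((\nabla_x\varphi)y,z)$, and $Ric(x,y)$ the trace of $z\mapsto R(z,x)y$, where $R=[\nabla,\nabla]-\nabla_{[\,,\,]}$. The structure is *Sasaki-like* if $F(X,Y,Z)=F(\xi,Y,Z)=F(\xi,\xi,Z)=0$ and $F(X,Y,\xi)=-g(X,Y)$ for all $X,Y,Z\in\ker\eta$. It is *Einstein* if $Ric=k\,g$ for a constant $k$. It is *contact homothetic* to a structure $(\varphi,\bar\xi,\bar\eta,\bar g)$ on $M$ if for some constants $u,v,w\in\mathbb R$ $$\bar\eta=e^{w}\eta,\qquad \bar\xi=e^{-w}\xi,\qquad \bar g(x,y)=e^{2u}\cos 2v\,g(x,y)+e^{2u}\sin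 2v\,g(x,\varphi y)+(e^{2w}-e^{2u}\cos 2v)\,\eta(x)\eta(y).$$ For constants $c,d\in\mathbb R$ with $c^2+d^2\neq 0$ consider, at a point of $M$, the condition $$Ric(x,y)=\frac{2n}{c^2+d^2}\bigl\{c\,g(x,y)-d\,g(x,\varphi y)+(c^2+d^2-c)\,\eta(x)\eta(y)\bigr\}\quad\text{for all tangent vectors }x,y.\qquad(*)$$ The structure is *$\eta$-complex-Einstein* if there are such constants $c,d$ for which $(*)$ holds at every point of $M$. **Proposition.** Let $(\varphi,\xi,\eta,g)$ be a Sasaki-like almost contact complex Riemannian structure on $M$. (i) If it is $\eta$-complex-Einstein, then it is contact homothetic to an Einstein Sasaki-like structure on $M$. (ii) Pointwise form: for all constants $c,d$ with $c^2+d^2\neq0$ it is contact homothetic to a Sasaki-like structure $(\varphi,\bar\xi,\bar\eta,\bar g)$ on $M$ whose Ricci tensor satisfies $\overline{Ric}=2n\,\bar g$ at every point of $M$ at which $(*)$ holds. -/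

import Mathlib

open scoped Manifold ContDiff

noncomputable section

/-! ### Local Riemannian geometry in coordinates

`G` is a field of bilinear forms on (an open part of) `ℝᵐ`: the coordinate expression of a
pseudo-Riemannian metric. -/

namespace LocalMetric

variable {m : ℕ}

/-- The coordinate space `ℝᵐ`. -/
abbrev Coord (m : ℕ) : Type := EuclideanSpace ℝ (Fin m)

/-- The Christoffel symbol of the Levi-Civita connection of `G` at `y`: the vector `Γ(u, v)` with
`2 G(Γ(u, v), w) = (∂_u G)(v, w) + (∂_v G)(u, w) - (∂_w G)(u, v)` for all `w`
(the Koszul formula for constant vector fields). -/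
def christoffel (G : Coord m → Coord m →L[ℝ] Coord m →L[ℝ] ℝ) (y u v : Coord m) : Coord m :=
  (G y).inverse ((1 / 2 : ℝ) •
    (fderiv ℝ G y u v + fderiv ℝ G y v u - ((fderiv ℝ G y).flip u).flip v))

/-- The covariant derivative `(∇_u Φ) v` of the field of endomorphisms `Φ`, with respect to the
Levi-Civita connection of `G`. -/
def covDerivEndo (G : Coord m → Coord m →L[ℝ] Coord m →L[ℝ] ℝ)
    (Φ : Coord m → Coord m →L[ℝ] Coord m) (y u v : Coord m) : Coord m :=
  fderiv ℝ Φ y u v + christoffel G y u (Φ y v) - Φ y (christoffel G y u v)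

/-- The curvature `R(u, v) w` of the Levi-Civita connection of `G`, for the convention
`R(u, v) = [∇_u, ∇_v] - ∇_[u, v]`. -/
def curvature (G : Coord m → Coord m →L[ℝ] Coord m →L[ℝ] ℝ) (y u v w : Coord m) : Coord m :=
  fderiv ℝ (fun z => christoffel G z v w) y u - fderiv ℝ (fun z => christoffel G z u w) y v
    + christoffel G y u (christoffel G y v w) - christoffel G y v (christoffel G y u w)

/-- The Ricci tensor `Ric(u, v)`: the trace of `w ↦ R(w, u) v`. -/
def ricci (G : Coord m → Coord m →L[ℝ] Coord m →L[ℝ] ℝ) (y u v : Coord m) : ℝ :=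
  ∑ i : Fin m, (curvature G y (EuclideanSpace.single i 1) u v) i

end LocalMetric

/-! ### Coordinate expressions of tensor fields on a manifold -/

namespace ChartExpr

open LocalMetric

variable {m : ℕ} {M : Type*} [TopologicalSpace M] [ChartedSpace (Coord m) M]

/-- The differential at `y` of the parametrization `e⁻¹` inverse to a chart `e`. -/
def dParam (e : OpenPartialHomeomorph M (Coord m)) (y : Coord m) :
    Coord m →L[ℝ] TangentSpace (𝓡 m) (e.symm y) :=
  mfderiv (𝓡 m) (𝓡 m) e.symm y

/-- The differential of the chart `e` at the point with coordinates `y`. -/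
def dChart (e : OpenPartialHomeomorph M (Coord m)) (y : Coord m) :
    TangentSpace (𝓡 m) (e.symm y) →L[ℝ] Coord m :=
  mfderiv (𝓡 m) (𝓡 m) e (e.symm y)

/-- A vector field in the chart `e`. -/
def vec (e : OpenPartialHomeomorph M (Coord m)) (ξ : ∀ p : M, TangentSpace (𝓡 m) p)
    (y : Coord m) : Coord m :=
  dChart e y (ξ (e.symm y))

/-- A 1-form in the chart `e`. -/
def form (e : OpenPartialHomeomorph M (Coord m)) (η : ∀ p : M, TangentSpace (𝓡 m) p →L[ℝ] ℝ)
    (y : Coord m) : Coord m →L[ℝ] ℝ :=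
  (η (e.symm y)).comp (dParam e y)

/-- A field of endomorphisms of the tangent spaces in the chart `e`. -/
def endo (e : OpenPartialHomeomorph M (Coord m))
    (φ : ∀ p : M, TangentSpace (𝓡 m) p →L[ℝ] TangentSpace (𝓡 m) p)
    (y : Coord m) : Coord m →L[ℝ] Coord m :=
  (dChart e y).comp ((φ (e.symm y)).comp (dParam e y))

/-- A field of bilinear forms in the chart `e`: the form `(u, v) ↦ g (de⁻¹ u, de⁻¹ v)`. -/
def bilin (e : OpenPartialHomeomorph M (Coord m))
    (g : ∀ p : M, TangentSpace (𝓡 m) p →L[ℝ] TangentSpace (𝓡 m) p →L[ℝ] ℝ)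
    (y : Coord m) : Coord m →L[ℝ] Coord m →L[ℝ] ℝ :=
  (ContinuousLinearMap.precomp ℝ (dParam e y)).comp ((g (e.symm y)).comp (dParam e y))

end ChartExpr

open LocalMetric ChartExpr

/-- An almost contact complex Riemannian structure (almost contact B-metric structure)
`(φ, ξ, η, g)` on a manifold `M` of dimension `2n + 1`. A tensor field is smooth when its
components are smooth in every chart of the atlas. -/
structure AlmostContactComplexRiemannian (n : ℕ) (M : Type*) [TopologicalSpace M]
    [ChartedSpace (Coord (2 * n + 1)) M] [IsManifold (𝓡 (2 * n + 1)) ∞ M] where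
  /-- the endomorphism of the tangent bundle -/
  φ : ∀ p : M, TangentSpace (𝓡 (2 * n + 1)) p →L[ℝ] TangentSpace (𝓡 (2 * n + 1)) p
  /-- the vertical vector field -/
  ξ : ∀ p : M, TangentSpace (𝓡 (2 * n + 1)) p
  /-- the 1-form -/
  η : ∀ p : M, TangentSpace (𝓡 (2 * n + 1)) p →L[ℝ] ℝ
  /-- the pseudo-Riemannian metric -/
  g : ∀ p : M, TangentSpace (𝓡 (2 * n + 1)) p →L[ℝ] TangentSpace (𝓡 (2 * n + 1)) p →L[ℝ] ℝ
  φ_smooth : ∀ e ∈ atlas (Coord (2 * n + 1)) M, ContDiffOn ℝ ∞ (endo e φ) e.target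
  ξ_smooth : ∀ e ∈ atlas (Coord (2 * n + 1)) M, ContDiffOn ℝ ∞ (vec e ξ) e.target
  η_smooth : ∀ e ∈ atlas (Coord (2 * n + 1)) M, ContDiffOn ℝ ∞ (form e η) e.target
  g_smooth : ∀ e ∈ atlas (Coord (2 * n + 1)) M, ContDiffOn ℝ ∞ (bilin e g) e.target
  φ_ξ : ∀ p, φ p (ξ p) = 0
  φ_sq : ∀ p x, φ p (φ p x) = -x + η p x • ξ p
  η_φ : ∀ p x, η p (φ p x) = 0
  η_ξ : ∀ p, η p (ξ p) = 1
  g_symm : ∀ p x y, g p x y = g p y x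
  /-- the metric has signature `(n + 1, n)` -/
  g_signature : ∀ p, ∃ b : Module.Basis (Fin (n + 1) ⊕ Fin n) ℝ (TangentSpace (𝓡 (2 * n + 1)) p),
    (∀ i j, i ≠ j → g p (b i) (b j) = 0) ∧
    (∀ i, g p (b (Sum.inl i)) (b (Sum.inl i)) = 1) ∧
    (∀ j, g p (b (Sum.inr j)) (b (Sum.inr j)) = -1)
  g_compat : ∀ p x y, g p (φ p x) (φ p y) = -g p x y + η p x * η p y

namespace AlmostContactComplexRiemannian

variable {n : ℕ} {M : Type*} [TopologicalSpace M]
  [ChartedSpace (Coord (2 * n + 1)) M] [IsManifold (𝓡 (2 * n + 1)) ∞ M]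

/-- The structure tensor `F(x, y, z) = g((∇_x φ) y, z)`, at the point with coordinates `q` in the
chart `e`, on vectors given by their coordinates. -/
def F (S : AlmostContactComplexRiemannian n M)
    (e : OpenPartialHomeomorph M (Coord (2 * n + 1))) (q x y z : Coord (2 * n + 1)) : ℝ :=
  bilin e S.g q (covDerivEndo (bilin e S.g) (endo e S.φ) q x y) z

/-- The Ricci tensor `Ric(x, y)` of `g`, at the point with coordinates `q` in the chart `e`. -/
def Ric (S : AlmostContactComplexRiemannian n M)
    (e : OpenPartialHomeomorph M (Coord (2 * n + 1))) (q x y : Coord (2 * n + 1)) : ℝ :=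
  ricci (bilin e S.g) q x y

/-- `S` is Sasaki-like: at every point (read in every chart of the atlas) and for all horizontal
`X`, `Y`, `Z`, i.e. vectors in the kernel of `η`,
`F(X, Y, Z) = F(ξ, Y, Z) = F(ξ, ξ, Z) = 0` and `F(X, Y, ξ) = -g(X, Y)`. -/
def IsSasakiLike (S : AlmostContactComplexRiemannian n M) : Prop :=
  ∀ e ∈ atlas (Coord (2 * n + 1)) M, ∀ q ∈ e.target, ∀ X Y Z : Coord (2 * n + 1),
    form e S.η q X = 0 → form e S.η q Y = 0 → form e S.η q Z = 0 →
      S.F e q X Y Z = 0 ∧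
      S.F e q (vec e S.ξ q) Y Z = 0 ∧
      S.F e q (vec e S.ξ q) (vec e S.ξ q) Z = 0 ∧
      S.F e q X Y (vec e S.ξ q) = -bilin e S.g q X Y

/-- `S` is Einstein: `Ric = k g` for a constant `k`. -/
def IsEinstein (S : AlmostContactComplexRiemannian n M) : Prop :=
  ∃ k : ℝ, ∀ e ∈ atlas (Coord (2 * n + 1)) M, ∀ q ∈ e.target, ∀ x y : Coord (2 * n + 1),
    S.Ric e q x y = k * bilin e S.g q x y

/-- At the point with coordinates `q` in the chart `e`, the Ricci tensor of `S` has the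
`η`-complex-Einstein form with coefficients `c`, `d`:
`Ric(x, y) = 2n / (c² + d²) * (c g(x, y) - d g(x, φ y) + (c² + d² - c) η(x) η(y))`. -/
def HasEtaComplexEinsteinForm (S : AlmostContactComplexRiemannian n M) (c d : ℝ)
    (e : OpenPartialHomeomorph M (Coord (2 * n + 1))) (q : Coord (2 * n + 1)) : Prop :=
  ∀ x y : Coord (2 * n + 1),
    S.Ric e q x y = 2 * (n : ℝ) / (c ^ 2 + d ^ 2) *
      (c * bilin e S.g q x y - d * bilin e S.g q x (endo e S.φ q y)
        + (c ^ 2 + d ^ 2 - c) * (form e S.η q x * form e S.η q y))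

/-- `S` is `η`-complex-Einstein: there are constants `c`, `d`, not both zero, for which the Ricci
tensor has the `η`-complex-Einstein form at every point. -/
def IsEtaComplexEinstein (S : AlmostContactComplexRiemannian n M) : Prop :=
  ∃ c d : ℝ, c ^ 2 + d ^ 2 ≠ 0 ∧
    ∀ e ∈ atlas (Coord (2 * n + 1)) M, ∀ q ∈ e.target, S.HasEtaComplexEinsteinForm c d e q

/-- `S'` is the image of `S` under a contact homothetic transformation: the contact conformal
transformation given by three constants `u`, `v`, `w`. -/
def IsContactHomothetic (S S' : AlmostContactComplexRiemannian n M) : Prop :=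
  ∃ u v w : ℝ, ∀ p : M,
    S'.φ p = S.φ p ∧
    S'.η p = Real.exp w • S.η p ∧
    S'.ξ p = Real.exp (-w) • S.ξ p ∧
    ∀ x y, S'.g p x y =
      Real.exp (2 * u) * Real.cos (2 * v) * S.g p x y
        + Real.exp (2 * u) * Real.sin (2 * v) * S.g p x (S.φ p y)
        + (Real.exp (2 * w) - Real.exp (2 * u) * Real.cos (2 * v)) * (S.η p x * S.η p y)

end AlmostContactComplexRiemannian

end

/-! The transformation with `w = 0` and real constants `a + ib = exp (2(u + iv))` replaces `g` by
`g' = a g + b g(·, φ·) + (1 - a) η ⊗ η` and keeps `φ`, `ξ`, `η`. The key fact is that it leaves the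
Ricci tensor of a Sasaki-like structure unchanged (`SasakiLikeOn.ricci_change`). With `a + ib = 1/(c
+ id)` the right side of the η-complex-Einstein condition is exactly `2n g'`, so `Ric' = Ric = 2n
g'` wherever that condition holds.

Ricci invariance comes from explicit formulas. The Sasaki-like condition amounts to a closed formula
for `∇φ` (`covDerivEndo_eq`), which yields `∇ξ = -φ` and `∇η = -g(·, φ·)`. Koszul's formula then
shows that the two connections differ by `T(u, v) ξ`, where `T = -b (g - η ⊗ η) - (1 - a) g(·, φ·)`
(`christoffel_change`). Since `T(·, ξ) = 0`, no term quadratic in `T` enters the curvature, and the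
difference of the curvatures is trace-free because `tr φ = 0` and `T(φv, w) = T(v, φw)`. The same
vertical correction shows that the new structure is again Sasaki-like.

All this is done for coordinate expressions on an open set. On the manifold one must also check that
`g'` has signature `(n + 1, n)`: multiplication by `exp (u + iv)` on `ker η`, extended by the
identity on `ξ`, is an isometry from `g'` to `g`. -/

noncomputable section

namespace LocalMetric

variable {m : ℕ}

/-! ### The Levi-Civita connection in coordinates -/

section Christoffel

variable (G : Coord m → Coord m →L[ℝ] Coord m →L[ℝ] ℝ) (y : Coord m)

lemma christoffel_add_left (u u' v : Coord m) :
    christoffel G y (u + u') v = christoffel G y u v + christoffel G y u' v := by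
  simp only [christoffel, ← map_add]
  congr 1
  ext w
  simp
  ring

lemma christoffel_smul_left (r : ℝ) (u v : Coord m) :
    christoffel G y (r • u) v = r • christoffel G y u v := by
  simp only [christoffel, ← map_smul]
  congr 1
  ext w
  simp
  ring

lemma christoffel_add_right (u v v' : Coord m) :
    christoffel G y u (v + v') = christoffel G y u v + christoffel G y u v' := by
  simp only [christoffel, ← map_add]
  congr 1
  ext w
  simp
  ring

lemma christoffel_smul_right (r : ℝ) (u v : Coord m) :
    christoffel G y u (r • v) = r • christoffel G y u v := by
  simp only [christoffel, ← map_smul]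
  congr 1
  ext w
  simp
  ring

variable (Φ : Coord m → Coord m →L[ℝ] Coord m)

lemma covDerivEndo_add_left (u u' v : Coord m) :
    covDerivEndo G Φ y (u + u') v = covDerivEndo G Φ y u v + covDerivEndo G Φ y u' v := by
  simp only [covDerivEndo, christoffel_add_left, map_add, add_apply]
  abel

lemma covDerivEndo_smul_left (r : ℝ) (u v : Coord m) :
    covDerivEndo G Φ y (r • u) v = r • covDerivEndo G Φ y u v := by
  simp only [covDerivEndo, christoffel_smul_left, map_smul, smul_apply,
    smul_add, smul_sub]

lemma covDerivEndo_add_right (u v v' : Coord m) :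
    covDerivEndo G Φ y u (v + v') = covDerivEndo G Φ y u v + covDerivEndo G Φ y u v' := by
  simp only [covDerivEndo, christoffel_add_right, map_add]
  abel

lemma covDerivEndo_smul_right (r : ℝ) (u v : Coord m) :
    covDerivEndo G Φ y u (r • v) = r • covDerivEndo G Φ y u v := by
  simp only [covDerivEndo, christoffel_smul_right, map_smul, smul_add, smul_sub]

end Christoffel

/-- A nondegenerate bilinear form on a finite-dimensional space is an isomorphism onto the dual. -/
lemma isInvertible_of_nondegenerate (B : Coord m →L[ℝ] Coord m →L[ℝ] ℝ)
    (hB : ∀ x, (∀ z, B x z = 0) → x = 0) : B.IsInvertible := by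
  have hinj : Function.Injective (B : Coord m →ₗ[ℝ] Coord m →L[ℝ] ℝ) := by
    rw [← LinearMap.ker_eq_bot, LinearMap.ker_eq_bot']
    intro x hx
    exact hB x fun z => by
      have := congrArg (fun f : Coord m →L[ℝ] ℝ => f z) hx
      simpa using this
  have hrank : Module.finrank ℝ (Coord m) = Module.finrank ℝ (Coord m →L[ℝ] ℝ) :=
    (InnerProductSpace.toDual ℝ (Coord m)).toLinearEquiv.finrank_eq
  refine ⟨(LinearMap.linearEquivOfInjective _ hinj hrank).toContinuousLinearEquiv, ?_⟩
  ext x z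
  rfl

/-- Two differentiable functions which agree on a neighbourhood of a point have the same
derivative there. -/
lemma hasFDerivAt_unique_of_eqOn {E F : Type*} [NormedAddCommGroup E] [NormedSpace ℝ E]
    [NormedAddCommGroup F] [NormedSpace ℝ F] {f g : E → F} {f' g' : E →L[ℝ] F} {U : Set E} {y : E}
    (hU : U ∈ nhds y) (hf : HasFDerivAt f f' y) (hg : HasFDerivAt g g' y)
    (hfg : ∀ z ∈ U, f z = g z) : f' = g' :=
  hf.unique (hg.congr_of_eventuallyEq (Filter.eventually_of_mem hU hfg))

/-! ### Almost contact B-metric structures in coordinates -/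

/-- The coordinate expression on an open set `U` of an almost contact complex Riemannian
structure. -/
structure AlmostContactOn (U : Set (Coord m)) (G : Coord m → Coord m →L[ℝ] Coord m →L[ℝ] ℝ)
    (Φ : Coord m → Coord m →L[ℝ] Coord m) (Ξ : Coord m → Coord m)
    (H : Coord m → Coord m →L[ℝ] ℝ) : Prop where
  isOpen : IsOpen U
  contDiffOn_metric : ContDiffOn ℝ ∞ G U
  contDiffOn_endo : ContDiffOn ℝ ∞ Φ U
  contDiffOn_vec : ContDiffOn ℝ ∞ Ξ U
  contDiffOn_form : ContDiffOn ℝ ∞ H U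
  endo_vec : ∀ y ∈ U, Φ y (Ξ y) = 0
  endo_endo : ∀ y ∈ U, ∀ x, Φ y (Φ y x) = -x + H y x • Ξ y
  form_endo : ∀ y ∈ U, ∀ x, H y (Φ y x) = 0
  form_vec : ∀ y ∈ U, H y (Ξ y) = 1
  symm : ∀ y ∈ U, ∀ x z, G y x z = G y z x
  nondegenerate : ∀ y ∈ U, ∀ x, (∀ z, G y x z = 0) → x = 0
  compat : ∀ y ∈ U, ∀ x z, G y (Φ y x) (Φ y z) = -G y x z + H y x * H y z

namespace AlmostContactOn

variable {U : Set (Coord m)} {G : Coord m → Coord m →L[ℝ] Coord m →L[ℝ] ℝ}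
  {Φ : Coord m → Coord m →L[ℝ] Coord m} {Ξ : Coord m → Coord m} {H : Coord m → Coord m →L[ℝ] ℝ}
  {y : Coord m}

section Algebra

variable (h : AlmostContactOn U G Φ Ξ H) (hy : y ∈ U)
include h hy

lemma metric_vec (x : Coord m) : G y x (Ξ y) = H y x := by
  have := h.compat y hy x (Ξ y)
  rw [h.endo_vec y hy, h.form_vec y hy, map_zero] at this
  linarith

lemma metric_vec_left (x : Coord m) : G y (Ξ y) x = H y x := by
  rw [h.symm y hy, h.metric_vec hy]

/-- Compatibility for the pair `x`, `φz`, combined with `φ² = -Id + η ⊗ ξ`. Self-adjointness of `φ`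
is what makes `g(·, φ·)` a symmetric form. -/
lemma metric_endo_left (x z : Coord m) : G y (Φ y x) z = G y x (Φ y z) := by
  have := h.compat y hy x (Φ y z)
  rw [h.endo_endo y hy, h.form_endo y hy, map_add, map_smul, h.metric_vec hy, h.form_endo y hy,
    map_neg] at this
  simp only [smul_zero, mul_zero, add_zero, neg_inj] at this
  exact this

lemma metric_endo_comm (x z : Coord m) : G y x (Φ y z) = G y z (Φ y x) := by
  rw [← h.metric_endo_left hy, h.symm y hy]

lemma isInvertible : (G y).IsInvertible := isInvertible_of_nondegenerate _ (h.nondegenerate y hy)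

lemma ext_metric {x x' : Coord m} (hx : ∀ z, G y x z = G y x' z) : x = x' := by
  refine sub_eq_zero.mp (h.nondegenerate y hy _ fun z => ?_)
  simp [hx z]

lemma hasFDerivAt_metric : HasFDerivAt G (fderiv ℝ G y) y :=
  ((h.contDiffOn_metric.contDiffAt (h.isOpen.mem_nhds hy)).differentiableAt (by simp)).hasFDerivAt

lemma hasFDerivAt_endo : HasFDerivAt Φ (fderiv ℝ Φ y) y :=
  ((h.contDiffOn_endo.contDiffAt (h.isOpen.mem_nhds hy)).differentiableAt (by simp)).hasFDerivAt

lemma hasFDerivAt_vec : HasFDerivAt Ξ (fderiv ℝ Ξ y) y :=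
  ((h.contDiffOn_vec.contDiffAt (h.isOpen.mem_nhds hy)).differentiableAt (by simp)).hasFDerivAt

lemma hasFDerivAt_form : HasFDerivAt H (fderiv ℝ H y) y :=
  ((h.contDiffOn_form.contDiffAt (h.isOpen.mem_nhds hy)).differentiableAt (by simp)).hasFDerivAt

lemma fderiv_metric_symm (u v w : Coord m) : fderiv ℝ G y u v w = fderiv ℝ G y u w v := by
  have hG := h.hasFDerivAt_metric hy
  have h1 := (hG.clm_apply (hasFDerivAt_const v y)).clm_apply (hasFDerivAt_const w y)
  have h2 := (hG.clm_apply (hasFDerivAt_const w y)).clm_apply (hasFDerivAt_const v y)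
  have := hasFDerivAt_unique_of_eqOn (h.isOpen.mem_nhds hy) h1 h2 fun z hz => h.symm z hz v w
  simpa using congrArg (fun f => f u) this

/-- The Koszul formula. -/
lemma metric_christoffel (u v w : Coord m) :
    G y (christoffel G y u v) w =
      1 / 2 * (fderiv ℝ G y u v w + fderiv ℝ G y v u w - fderiv ℝ G y w u v) := by
  rw [christoffel, (h.isInvertible hy).self_apply_inverse]
  simp

lemma eq_christoffel {x u v : Coord m} (hx : ∀ w, G y x w =
    1 / 2 * (fderiv ℝ G y u v w + fderiv ℝ G y v u w - fderiv ℝ G y w u v)) :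
    christoffel G y u v = x :=
  h.ext_metric hy fun z => by rw [h.metric_christoffel hy, hx]

lemma christoffel_symm (u v : Coord m) : christoffel G y u v = christoffel G y v u :=
  h.eq_christoffel hy fun w => by
    rw [h.metric_christoffel hy, h.fderiv_metric_symm hy w u v]
    ring

/-- The metric is parallel. -/
lemma fderiv_metric (u v w : Coord m) :
    fderiv ℝ G y u v w = G y (christoffel G y u v) w + G y v (christoffel G y u w) := by
  rw [h.symm y hy v, h.metric_christoffel hy, h.metric_christoffel hy,
    h.fderiv_metric_symm hy u w v]
  ring

/-- The structure tensor `F` is symmetric in its last two arguments. -/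
lemma metric_covDerivEndo_comm (u v w : Coord m) :
    G y (covDerivEndo G Φ y u v) w = G y (covDerivEndo G Φ y u w) v := by
  have hG := h.hasFDerivAt_metric hy
  have hΦ := h.hasFDerivAt_endo hy
  have h1 := (hG.clm_apply (hΦ.clm_apply (hasFDerivAt_const v y))).clm_apply
    (hasFDerivAt_const w y)
  have h2 := (hG.clm_apply (hΦ.clm_apply (hasFDerivAt_const w y))).clm_apply
    (hasFDerivAt_const v y)
  have := hasFDerivAt_unique_of_eqOn (h.isOpen.mem_nhds hy) h1 h2 fun z hz => by
    rw [h.metric_endo_left hz, h.symm z hz]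
  have := congrArg (fun f => f u) this
  simp only [ContinuousLinearMap.comp_zero, zero_add,
    ContinuousLinearMap.flip_apply, add_apply,
    ContinuousLinearMap.comp_apply] at this
  rw [h.fderiv_metric hy, h.fderiv_metric hy, h.symm y hy (Φ y v), h.symm y hy (Φ y w)] at this
  simp only [covDerivEndo, map_add, map_sub, add_apply,
    sub_apply]
  rw [h.metric_endo_left hy _ w, h.metric_endo_left hy _ v]
  linarith

/-- Obtained by differentiating `φξ = 0`. -/
lemma covDerivEndo_vec (u : Coord m) :
    covDerivEndo G Φ y u (Ξ y) = -Φ y (fderiv ℝ Ξ y u + christoffel G y u (Ξ y)) := by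
  have h1 := (h.hasFDerivAt_endo hy).clm_apply (h.hasFDerivAt_vec hy)
  have := hasFDerivAt_unique_of_eqOn (h.isOpen.mem_nhds hy) h1
    (hasFDerivAt_const (0 : Coord m) y) h.endo_vec
  have := congrArg (fun f => f u) this
  simp only [ContinuousLinearMap.flip_apply, add_apply,
    ContinuousLinearMap.comp_apply, zero_apply] at this
  rw [covDerivEndo, h.endo_vec y hy, ← zero_smul ℝ (0 : Coord m), christoffel_smul_right,
    zero_smul, map_add, eq_neg_of_add_eq_zero_right this]
  abel

/-- Obtained by differentiating `g(ξ, ξ) = 1`: the vector `∇_u ξ` is horizontal. -/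
lemma form_covDeriv_vec (u : Coord m) :
    H y (fderiv ℝ Ξ y u + christoffel G y u (Ξ y)) = 0 := by
  have hΞ := h.hasFDerivAt_vec hy
  have h1 := ((h.hasFDerivAt_metric hy).clm_apply hΞ).clm_apply hΞ
  have := hasFDerivAt_unique_of_eqOn (h.isOpen.mem_nhds hy) h1
    (hasFDerivAt_const (1 : ℝ) y) fun z hz => by rw [h.metric_vec hz, h.form_vec z hz]
  have := congrArg (fun f => f u) this
  simp only [ContinuousLinearMap.flip_apply, add_apply,
    ContinuousLinearMap.comp_apply, zero_apply] at this
  rw [h.fderiv_metric hy] at this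
  rw [h.metric_vec hy, h.metric_vec_left hy, h.metric_vec hy, h.metric_vec_left hy] at this
  rw [map_add]
  linarith

-- The curvature differentiates Christoffel symbols, so these must be genuinely differentiable.
-- Smoothness follows from that of `G` and of inversion at an invertible map.
set_option maxSynthPendingDepth 4 in
lemma contDiffAt_christoffel (v w : Coord m) :
    ContDiffAt ℝ 1 (fun z => christoffel G z v w) y := by
  have hG := h.contDiffOn_metric.contDiffAt (h.isOpen.mem_nhds hy)
  have hG' : ContDiffAt ℝ 1 (fderiv ℝ G) y := hG.fderiv_right (m := 1) (by norm_cast)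
  have hinv : ContDiffAt ℝ 1 (fun z => (G z).inverse) y :=
    (h.isInvertible hy).contDiffAt_map_inverse.comp y (hG.of_le (by norm_cast))
  have hv : ContDiffAt ℝ 1 (fun z => (fderiv ℝ G z).flip v) y :=
    ((ContinuousLinearMap.flipₗᵢ ℝ (Coord m) (Coord m)
      (Coord m →L[ℝ] ℝ)).toContinuousLinearEquiv.contDiff.contDiffAt.comp y
        hG').clm_apply contDiffAt_const
  have hvw : ContDiffAt ℝ 1 (fun z => ((fderiv ℝ G z).flip v).flip w) y :=
    ((ContinuousLinearMap.flipₗᵢ ℝ (Coord m) (Coord m)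
      ℝ).toContinuousLinearEquiv.contDiff.contDiffAt.comp y hv).clm_apply contDiffAt_const
  have h1 : ContDiffAt ℝ 1 (fun z => fderiv ℝ G z v w) y :=
    (hG'.clm_apply contDiffAt_const).clm_apply contDiffAt_const
  have h2 : ContDiffAt ℝ 1 (fun z => fderiv ℝ G z w v) y :=
    (hG'.clm_apply contDiffAt_const).clm_apply contDiffAt_const
  exact hinv.clm_apply (((h1.add h2).sub hvw).const_smul (1 / 2 : ℝ))

lemma hasFDerivAt_christoffel (v w : Coord m) :
    HasFDerivAt (fun z => christoffel G z v w) (fderiv ℝ (fun z => christoffel G z v w) y) y :=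
  ((h.contDiffAt_christoffel hy v w).differentiableAt (by simp)).hasFDerivAt

end Algebra

end AlmostContactOn

/-! ### Traces in coordinates, and the vanishing of the trace of `φ` -/

/-- A real matrix with `A ^ 3 = -A` has trace zero. -/
lemma trace_eq_zero_of_cube_eq_neg (A : Matrix (Fin m) (Fin m) ℝ) (hA : A * (A * A) = -A) :
    A.trace = 0 := by
  set B : Matrix (Fin m) (Fin m) ℂ := A.map (algebraMap ℝ ℂ) with hB
  have hBBB : B * (B * B) = -B := by
    rw [hB, ← Matrix.map_mul, ← Matrix.map_mul, hA]
    ext i j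
    simp
  -- Every complex eigenvalue satisfies `z³ = -z`, so it is `0` or `±i`; the trace is then both real
  -- and purely imaginary.
  have hroot : ∀ z ∈ B.charpoly.roots, z.re = 0 := by
    intro z hz
    have hz' : z ∈ spectrum ℂ B := by
      rw [Matrix.mem_spectrum_iff_isRoot_charpoly]
      exact Polynomial.isRoot_of_mem_roots hz
    rw [← Matrix.spectrum_toLin', ← Module.End.hasEigenvalue_iff_mem_spectrum] at hz'
    obtain ⟨v, hv⟩ := hz'.exists_hasEigenvector
    have h1 : B.mulVec v = z • v := by simpa using hv.apply_eq_smul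
    have h2 : (B * (B * B)).mulVec v = (-B).mulVec v := by rw [hBBB]
    rw [← Matrix.mulVec_mulVec, ← Matrix.mulVec_mulVec, Matrix.neg_mulVec] at h2
    simp only [h1, Matrix.mulVec_smul, smul_smul, ← neg_smul] at h2
    have h3 : z * z * z = -z := smul_left_injective ℂ hv.2 h2
    have h4 : z * (z * z + 1) = 0 := by linear_combination h3
    rcases mul_eq_zero.mp h4 with h5 | h5
    · simp [h5]
    · have hre := congrArg Complex.re h5
      have him := congrArg Complex.im h5
      simp at hre him
      by_contra hne
      have : z.im = 0 := by
        have : z.re * z.im = 0 := by linarith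
        exact (mul_eq_zero.mp this).resolve_left hne
      rw [this] at hre
      nlinarith [sq_nonneg z.re]
  have htr : ((A.trace : ℝ) : ℂ) = B.charpoly.roots.sum := by
    rw [← Matrix.trace_eq_sum_roots_charpoly, hB, Matrix.trace, Matrix.trace]
    simp
  have : ∀ s : Multiset ℂ, (∀ z ∈ s, z.re = 0) → s.sum.re = 0 := by
    intro s
    induction s using Multiset.induction_on with
    | empty => simp
    | cons a s ih =>
      intro hs
      rw [Multiset.sum_cons, Complex.add_re, hs a (by simp), ih fun z hz => hs z (by simp [hz]),
        add_zero]
  have := this _ hroot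
  rwa [← htr, Complex.ofReal_re] at this

lemma sum_single_smul (x : Coord m) : ∑ i, x i • EuclideanSpace.single i (1 : ℝ) = x := by
  simpa using (EuclideanSpace.basisFun (Fin m) ℝ).sum_repr x

lemma sum_apply_single_mul (f : Coord m →L[ℝ] ℝ) (x : Coord m) :
    ∑ i, f (EuclideanSpace.single i 1) * x i = f x := by
  conv_rhs => rw [← sum_single_smul x, map_sum]
  exact Finset.sum_congr rfl fun i _ => by rw [map_smul, smul_eq_mul, mul_comm]

lemma sum_apply_single_eq_zero (f : Coord m →L[ℝ] Coord m)
    (hf : ∀ x, f (f (f x)) = -f x) : ∑ i, f (EuclideanSpace.single i 1) i = 0 := by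
  let b := (EuclideanSpace.basisFun (Fin m) ℝ).toBasis
  have h1 : LinearMap.toMatrix b b (f : Coord m →ₗ[ℝ] Coord m) =
      Matrix.of fun i j => f (EuclideanSpace.single j 1) i := by
    ext i j
    simp [LinearMap.toMatrix_apply, b]
  have h2 := trace_eq_zero_of_cube_eq_neg
    (LinearMap.toMatrix b b (f : Coord m →ₗ[ℝ] Coord m)) (by
      rw [← LinearMap.toMatrix_comp, ← LinearMap.toMatrix_comp, ← map_neg]
      congr 1
      ext x
      simp [hf])
  rw [h1] at h2
  simpa [Matrix.trace] using h2

/-! ### Sasaki-like structures in coordinates -/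

/-- The coordinate expression on an open set of a Sasaki-like structure. -/
structure SasakiLikeOn (U : Set (Coord m)) (G : Coord m → Coord m →L[ℝ] Coord m →L[ℝ] ℝ)
    (Φ : Coord m → Coord m →L[ℝ] Coord m) (Ξ : Coord m → Coord m)
    (H : Coord m → Coord m →L[ℝ] ℝ) : Prop extends AlmostContactOn U G Φ Ξ H where
  sasaki : ∀ y ∈ U, ∀ X Y Z, H y X = 0 → H y Y = 0 → H y Z = 0 →
    G y (covDerivEndo G Φ y X Y) Z = 0 ∧
    G y (covDerivEndo G Φ y (Ξ y) Y) Z = 0 ∧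
    G y (covDerivEndo G Φ y (Ξ y) (Ξ y)) Z = 0 ∧
    G y (covDerivEndo G Φ y X Y) (Ξ y) = -G y X Y

namespace SasakiLikeOn

variable {U : Set (Coord m)} {G : Coord m → Coord m →L[ℝ] Coord m →L[ℝ] ℝ}
  {Φ : Coord m → Coord m →L[ℝ] Coord m} {Ξ : Coord m → Coord m} {H : Coord m → Coord m →L[ℝ] ℝ}
  {y : Coord m} (h : SasakiLikeOn U G Φ Ξ H) (hy : y ∈ U)
include h hy

/-- The covariant derivative of `φ` on a Sasaki-like manifold:
`(∇_u φ) v = -g(u, v) ξ - η(v) u + 2 η(u) η(v) ξ`. -/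
lemma covDerivEndo_eq (u v : Coord m) : covDerivEndo G Φ y u v =
    -G y u v • Ξ y - H y v • u + (2 * (H y u * H y v)) • Ξ y := by
  have hξ := h.form_vec y hy
  -- Splitting all three arguments into horizontal and vertical parts reduces the formula to eight
  -- components of `F`.
  have decomp : ∀ x : Coord m, ∃ X, ∃ r : ℝ, H y X = 0 ∧ x = X + r • Ξ y := fun x =>
    ⟨x - H y x • Ξ y, H y x, by simp [hξ], by simp⟩
  refine h.ext_metric hy fun w => ?_
  obtain ⟨X, α, hX, rfl⟩ := decomp u
  obtain ⟨Y, β, hY, rfl⟩ := decomp v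
  obtain ⟨Z, γ, hZ, rfl⟩ := decomp w
  have h0 : H y (0 : Coord m) = 0 := map_zero _
  obtain ⟨e1, e2, e3, e4⟩ := h.sasaki y hy X Y Z hX hY hZ
  -- Symmetry of `F` in its last two arguments gives `F(ξ, Y, ξ)` and `F(X, ξ, Z)`, which the
  -- definition does not list.
  obtain ⟨-, -, e5, e6⟩ := h.sasaki y hy X Z Y hX hZ hY
  rw [h.metric_covDerivEndo_comm hy] at e5 e6
  -- `F(x, ξ, ξ) = 0` holds in general, because `(∇_x φ) ξ` lies in the image of `φ`.
  have e7 : ∀ x, G y (covDerivEndo G Φ y x (Ξ y)) (Ξ y) = 0 := fun x => by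
    rw [h.metric_vec hy, h.covDerivEndo_vec hy, map_neg, h.form_endo y hy, neg_zero]
  simp only [covDerivEndo_add_left, covDerivEndo_add_right, covDerivEndo_smul_left,
    covDerivEndo_smul_right, map_add, map_sub, map_smul, map_neg, add_apply, sub_apply,
    smul_apply, smul_eq_mul, h.metric_vec hy, h.metric_vec_left hy, hX, hY, hZ, hξ, neg_smul,
    neg_apply]
  rw [h.metric_vec hy] at e4 e5
  simp only [h.metric_vec hy] at e7
  linear_combination e1 + γ * e4 + β * e6 + β * γ * e7 X + α * e2 + α * γ * e5
    + α * β * e3 + α * β * γ * e7 (Ξ y)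

/-- `∇_u ξ = -φ u`, in coordinates. -/
lemma fderiv_vec (u : Coord m) :
    fderiv ℝ Ξ y u = -Φ y u - christoffel G y u (Ξ y) := by
  have h1 := h.covDerivEndo_vec hy u
  rw [h.covDerivEndo_eq hy, h.metric_vec hy, h.form_vec y hy] at h1
  -- A second `φ` recovers `∇_u ξ` from `φ(∇_u ξ)`, since `φ² = -Id` on horizontal vectors.
  have h2 := congrArg (Φ y) h1
  rw [map_neg, h.endo_endo y hy, h.form_covDeriv_vec hy] at h2
  simp only [map_add, map_sub, map_smul, h.endo_vec y hy, smul_zero, one_smul, zero_smul,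
    add_zero, neg_neg, zero_sub] at h2
  rw [h2]
  abel

lemma fderiv_endo (u v : Coord m) : fderiv ℝ Φ y u v =
    -G y u v • Ξ y - H y v • u + (2 * (H y u * H y v)) • Ξ y
      - christoffel G y u (Φ y v) + Φ y (christoffel G y u v) := by
  rw [← h.covDerivEndo_eq hy, covDerivEndo]
  abel

/-- `(∇_u η) v = -g(u, φ v)`, in coordinates. -/
lemma fderiv_form (u v : Coord m) :
    fderiv ℝ H y u v = H y (christoffel G y u v) - G y u (Φ y v) := by
  have h1 := ((h.hasFDerivAt_metric hy).clm_apply (hasFDerivAt_const v y)).clm_apply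
    (h.hasFDerivAt_vec hy)
  have := hasFDerivAt_unique_of_eqOn (h.isOpen.mem_nhds hy)
    ((h.hasFDerivAt_form hy).clm_apply (hasFDerivAt_const v y)) h1
    fun z hz => (h.metric_vec hz v).symm
  have := congrArg (fun f => f u) this
  simp only [ContinuousLinearMap.comp_zero, zero_add,
    ContinuousLinearMap.flip_apply, add_apply, ContinuousLinearMap.comp_apply] at this
  rw [this, h.fderiv_vec hy, h.fderiv_metric hy, h.metric_vec hy, map_sub, map_neg,
    h.metric_endo_comm hy]
  ring

/-! Comparison with the Levi-Civita connection of `g' = a g + b g(·, φ ·) + (1 - a) η ⊗ η`. -/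

section Change

variable {G' : Coord m → Coord m →L[ℝ] Coord m →L[ℝ] ℝ} {a b : ℝ}
  (h' : AlmostContactOn U G' Φ Ξ H)
  (hG' : ∀ y ∈ U, ∀ u v, G' y u v = a * G y u v + b * G y u (Φ y v) + (1 - a) * (H y u * H y v))
include h' hG'

lemma fderiv_metric_change (u v w : Coord m) : fderiv ℝ G' y u v w =
    a * fderiv ℝ G y u v w + b * (fderiv ℝ G y u v (Φ y w) + G y v (fderiv ℝ Φ y u w))
      + (1 - a) * (fderiv ℝ H y u v * H y w + H y v * fderiv ℝ H y u w) := by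
  have hG := (h.hasFDerivAt_metric hy).clm_apply (hasFDerivAt_const v y)
  have hΦ := (h.hasFDerivAt_endo hy).clm_apply (hasFDerivAt_const w y)
  have hHv := (h.hasFDerivAt_form hy).clm_apply (hasFDerivAt_const v y)
  have hHw := (h.hasFDerivAt_form hy).clm_apply (hasFDerivAt_const w y)
  have h1 := (((hG.clm_apply (hasFDerivAt_const w y)).const_mul a).add
    ((hG.clm_apply hΦ).const_mul b)).add ((hHv.mul hHw).const_mul (1 - a))
  have h2 := ((h'.hasFDerivAt_metric hy).clm_apply (hasFDerivAt_const v y)).clm_apply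
    (hasFDerivAt_const w y)
  have := hasFDerivAt_unique_of_eqOn (h.isOpen.mem_nhds hy) h2 h1 fun z hz => hG' z hz v w
  have := congrArg (fun f => f u) this
  simp only [ContinuousLinearMap.comp_zero, zero_add, smul_apply, smul_eq_mul,
    ContinuousLinearMap.flip_apply, add_apply, ContinuousLinearMap.comp_apply] at this
  rw [this]
  ring

/-- Write `T` for the coefficient of `ξ`, a symmetric form. The formulas for `∇φ` and `∇η` give
`(∇_u g')(v, w) = T(u, v) η(w) + T(u, w) η(v)`. In Koszul's alternating sum only `T(u, v) η(w)`
survives, and this is `g'(T(u, v) ξ, w)` because `g'(ξ, ·) = η`. -/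
lemma christoffel_change (u v : Coord m) : christoffel G' y u v = christoffel G y u v +
    (-b * (G y u v - H y u * H y v) - (1 - a) * G y u (Φ y v)) • Ξ y := by
  refine h'.eq_christoffel hy fun w => ?_
  simp only [h.fderiv_metric_change hy h' hG', hG' y hy, h.fderiv_endo hy, h.fderiv_form hy,
    h.fderiv_metric hy, map_add, map_sub, map_smul, add_apply,
    smul_apply, smul_eq_mul, h.metric_vec hy, h.metric_vec_left hy, h.form_vec y hy,
    h.form_endo y hy]
  -- The symmetries of `Γ`, `g` and `g(·, φ·)` put equal terms in one form, so that `ring` can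
  -- cancel them.
  rw [h.christoffel_symm hy v u, h.christoffel_symm hy w u, h.christoffel_symm hy w v,
    h.symm y hy v (christoffel G y u w), h.symm y hy u (christoffel G y v w),
    h.metric_endo_comm hy v (christoffel G y u w), h.metric_endo_comm hy u (christoffel G y v w),
    h.symm y hy v u, h.symm y hy w v,
    h.metric_endo_comm hy v u, h.metric_endo_comm hy w u, h.metric_endo_comm hy w v]
  ring

lemma fderiv_christoffel_change (u v w : Coord m) :
    fderiv ℝ (fun z => christoffel G' z v w) y u = fderiv ℝ (fun z => christoffel G z v w) y u
      + (-b * (fderiv ℝ G y u v w - (fderiv ℝ H y u v * H y w + H y v * fderiv ℝ H y u w))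
        - (1 - a) * (fderiv ℝ G y u v (Φ y w) + G y v (fderiv ℝ Φ y u w))) • Ξ y
      + (-b * (G y v w - H y v * H y w) - (1 - a) * G y v (Φ y w)) • fderiv ℝ Ξ y u := by
  have hG := (h.hasFDerivAt_metric hy).clm_apply (hasFDerivAt_const v y)
  have hΦ := (h.hasFDerivAt_endo hy).clm_apply (hasFDerivAt_const w y)
  have hHv := (h.hasFDerivAt_form hy).clm_apply (hasFDerivAt_const v y)
  have hHw := (h.hasFDerivAt_form hy).clm_apply (hasFDerivAt_const w y)
  have hT := (((hG.clm_apply (hasFDerivAt_const w y)).sub (hHv.mul hHw)).const_mul (-b)).sub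
    ((hG.clm_apply hΦ).const_mul (1 - a))
  have h1 := (h.hasFDerivAt_christoffel hy v w).add (hT.smul (h.hasFDerivAt_vec hy))
  have := hasFDerivAt_unique_of_eqOn (h.isOpen.mem_nhds hy) (h'.hasFDerivAt_christoffel hy v w) h1
    fun z hz => h.christoffel_change hz h' hG' v w
  have := congrArg (fun f => f u) this
  simp only [ContinuousLinearMap.comp_zero, zero_add, smul_apply, smul_eq_mul,
    ContinuousLinearMap.flip_apply, add_apply, sub_apply, ContinuousLinearMap.comp_apply,
    ContinuousLinearMap.smulRight_apply, Pi.sub_apply, Pi.mul_apply] at this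
  rw [this]
  module

/-- The covariant derivative of `φ` changes by a vertical term. -/
lemma covDerivEndo_change (u v : Coord m) : covDerivEndo G' Φ y u v = covDerivEndo G Φ y u v +
    (-b * G y u (Φ y v) + (1 - a) * (G y u v - H y u * H y v)) • Ξ y := by
  simp only [covDerivEndo, h.christoffel_change hy h' hG', map_add, map_smul, h.endo_vec y hy,
    h.form_endo y hy, h.endo_endo y hy, h.metric_vec hy, map_neg]
  module

/-- For connections differing by `T ⊗ ξ`, the curvature changes by the skew part of `∇T` times `ξ`,
by `T(v, w) ∇_u ξ - T(u, w) ∇_v ξ`, and by quadratic terms. The last vanish as `T(·, ξ) = 0`, and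
`∇ξ = -φ` gives the final two summands. -/
lemma curvature_change (u v w : Coord m) : curvature G' y u v w = curvature G y u v w
    + (H y v * (-b * G y u (Φ y w) + (1 - a) * (G y u w - H y u * H y w))
      - H y u * (-b * G y v (Φ y w) + (1 - a) * (G y v w - H y v * H y w))) • Ξ y
    - (-b * (G y v w - H y v * H y w) - (1 - a) * G y v (Φ y w)) • Φ y u
    + (-b * (G y u w - H y u * H y w) - (1 - a) * G y u (Φ y w)) • Φ y v := by
  simp only [curvature, h.fderiv_christoffel_change hy h' hG', h.christoffel_change hy h' hG',
    christoffel_add_right, christoffel_smul_right, h.fderiv_endo hy, h.fderiv_form hy,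
    h.fderiv_metric hy, h.fderiv_vec hy, map_add, map_sub, map_smul, h.metric_vec hy,
    smul_eq_mul, h.form_vec y hy, h.endo_vec y hy, map_zero]
  rw [h.christoffel_symm hy v u, h.symm y hy v u, h.metric_endo_comm hy v u]
  have e1 := h.metric_endo_comm hy u (christoffel G y v w)
  have e2 := h.metric_endo_comm hy v (christoffel G y u w)
  module

/-- The Ricci tensor of a Sasaki-like structure is invariant under contact homotheties. -/
lemma ricci_change (v w : Coord m) : ricci G' y v w = ricci G y v w := by
  -- With `T` the difference form of the connections, these two functionals are `T(·, w)` and `T(·,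
  -- φw)`.
  set T : Coord m →L[ℝ] ℝ := (-b) • (G y w - H y w • H y) - (1 - a) • (G y (Φ y w)) with hT
  set T' : Coord m →L[ℝ] ℝ := (-b) • (G y (Φ y w)) + (1 - a) • (G y w - H y w • H y) with hT'
  have hsym : ∀ x, G y x w = G y w x := fun x => h.symm y hy x w
  have hsym' : ∀ x, G y x (Φ y w) = G y (Φ y w) x := fun x => h.symm y hy x (Φ y w)
  have key : ∀ u, curvature G' y u v w = curvature G y u v w + (H y v * T' u) • Ξ y
      - (T' v * H y u) • Ξ y - T v • Φ y u + T u • Φ y v := fun u => by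
    rw [h.curvature_change hy h' hG']
    simp only [hT, hT', add_apply, sub_apply, smul_apply, smul_eq_mul, hsym, hsym']
    module
  have htr : ∑ i, Φ y (EuclideanSpace.single i 1) i = 0 :=
    sum_apply_single_eq_zero (Φ y) fun x => by
      rw [h.endo_endo y hy, h.form_endo y hy, zero_smul, add_zero]
  simp only [ricci, key, PiLp.add_apply, PiLp.sub_apply, PiLp.smul_apply, smul_eq_mul,
    Finset.sum_add_distrib, Finset.sum_sub_distrib, mul_assoc, ← Finset.mul_sum, htr,
    sum_apply_single_mul]
  -- The traces left over are `η(v) T'(ξ) - T'(v) + T(φv)`, which vanish since `T'(ξ) = 0` and `T ∘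
  -- φ = T'`.
  simp only [hT, hT', add_apply, sub_apply, smul_apply, smul_eq_mul, h.metric_vec hy,
    h.form_vec y hy, h.form_endo y hy, ← hsym, ← hsym', h.compat y hy]
  rw [h.metric_endo_left hy v w]
  ring

end Change

end SasakiLikeOn

/-- A structure obtained by a contact homothety from a Sasaki-like one is Sasaki-like. -/
lemma SasakiLikeOn.sasakiLikeOn_change {U : Set (Coord m)}
    {G G' : Coord m → Coord m →L[ℝ] Coord m →L[ℝ] ℝ} {Φ : Coord m → Coord m →L[ℝ] Coord m}
    {Ξ : Coord m → Coord m} {H : Coord m → Coord m →L[ℝ] ℝ} {a b : ℝ}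
    (h : SasakiLikeOn U G Φ Ξ H) (h' : AlmostContactOn U G' Φ Ξ H)
    (hG' : ∀ y ∈ U, ∀ u v,
      G' y u v = a * G y u v + b * G y u (Φ y v) + (1 - a) * (H y u * H y v)) :
    SasakiLikeOn U G' Φ Ξ H where
  toAlmostContactOn := h'
  sasaki := by
    intro y hy X Y Z hX hY hZ
    -- The vertical correction to `∇φ` affects only the last identity, where it turns `-g(X, Y)`
    -- into `-a g(X, Y) - b g(X, φY) = -g'(X, Y)`.
    simp only [h.covDerivEndo_change hy h' hG', h.covDerivEndo_eq hy, hG' y hy]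
    simp only [map_add, map_sub, map_smul, map_zero, add_apply, sub_apply,
      smul_apply, smul_eq_mul, h.metric_vec hy, h.metric_vec_left hy, h.form_vec y hy,
      h.form_endo y hy, h.endo_vec y hy, hX, hY, hZ]
    refine ⟨by ring, by ring, by ring, by ring⟩

end LocalMetric

open LocalMetric ChartExpr

/-! ### Passing between tangent spaces and charts -/

namespace ChartExpr

variable {m : ℕ} {M : Type*} [TopologicalSpace M] [ChartedSpace (Coord m) M]
  {e : OpenPartialHomeomorph M (Coord m)}

lemma form_apply (η : ∀ p : M, TangentSpace (𝓡 m) p →L[ℝ] ℝ) (y v : Coord m) :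
    form e η y v = η (e.symm y) (dParam e y v) := rfl

lemma bilin_apply (g : ∀ p : M, TangentSpace (𝓡 m) p →L[ℝ] TangentSpace (𝓡 m) p →L[ℝ] ℝ)
    (y u v : Coord m) : bilin e g y u v = g (e.symm y) (dParam e y u) (dParam e y v) := rfl

variable [IsManifold (𝓡 m) ∞ M]

lemma dChart_dParam (he : e ∈ atlas (Coord m) M) {y : Coord m} (hy : y ∈ e.target) (v : Coord m) :
    dChart e y (dParam e y v) = v :=
  congrArg (fun f => f v)
    ((mdifferentiable_of_mem_atlas (I := 𝓡 m) he).comp_symm_deriv hy)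

lemma dParam_dChart (he : e ∈ atlas (Coord m) M) {y : Coord m} (hy : y ∈ e.target)
    (x : TangentSpace (𝓡 m) (e.symm y)) : dParam e y (dChart e y x) = x := by
  -- In finite dimension a one-sided inverse is two-sided; the tangent space is identified with its
  -- model so that both maps are endomorphisms of one space.
  let A : Coord m →ₗ[ℝ] Coord m := (dChart e y : TangentSpace (𝓡 m) (e.symm y) →ₗ[ℝ] Coord m)
  let B : Coord m →ₗ[ℝ] Coord m := (dParam e y : Coord m →ₗ[ℝ] TangentSpace (𝓡 m) (e.symm y))
  have hAB : A * B = 1 := LinearMap.ext fun v => dChart_dParam he hy v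
  have hBA : B * A = 1 := mul_eq_one_comm.mp hAB
  exact congrArg (fun f => f x) hBA

lemma dParam_endo (he : e ∈ atlas (Coord m) M) {y : Coord m} (hy : y ∈ e.target)
    (φ : ∀ p : M, TangentSpace (𝓡 m) p →L[ℝ] TangentSpace (𝓡 m) p) (v : Coord m) :
    dParam e y (endo e φ y v) = φ (e.symm y) (dParam e y v) :=
  dParam_dChart he hy _

lemma dParam_vec (he : e ∈ atlas (Coord m) M) {y : Coord m} (hy : y ∈ e.target)
    (ξ : ∀ p : M, TangentSpace (𝓡 m) p) : dParam e y (vec e ξ y) = ξ (e.symm y) :=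
  dParam_dChart he hy _

lemma dParam_injective (he : e ∈ atlas (Coord m) M) {y : Coord m} (hy : y ∈ e.target) :
    Function.Injective (dParam e y) :=
  Function.LeftInverse.injective (g := dChart e y) (dChart_dParam he hy)

end ChartExpr

/-! ### The contact homothetic structure on the manifold -/

namespace AlmostContactComplexRiemannian

variable {n : ℕ} {M : Type*} [TopologicalSpace M]
  [ChartedSpace (Coord (2 * n + 1)) M] [IsManifold (𝓡 (2 * n + 1)) ∞ M]
  (S : AlmostContactComplexRiemannian n M)

lemma g_nondegenerate (p : M) (x : TangentSpace (𝓡 (2 * n + 1)) p)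
    (hx : ∀ z, S.g p x z = 0) : x = 0 := by
  obtain ⟨b, hb, hb1, hb2⟩ := S.g_signature p
  have key : ∀ j, b.repr x j * S.g p (b j) (b j) = 0 := fun j => by
    have h := hx (b j)
    rw [← b.sum_repr x, map_sum, sum_apply,
      Finset.sum_eq_single j (fun i _ hij => by simp [hb i j hij]) (by simp)] at h
    simpa using h
  refine b.ext_elem fun j => ?_
  have := key j
  rcases j with j | j
  · simpa [hb1] using this
  · simpa [hb2] using this

lemma almostContactOn {e : OpenPartialHomeomorph M (Coord (2 * n + 1))}
    (he : e ∈ atlas (Coord (2 * n + 1)) M) :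
    AlmostContactOn e.target (bilin e S.g) (endo e S.φ) (vec e S.ξ) (form e S.η) where
  isOpen := e.open_target
  contDiffOn_metric := S.g_smooth e he
  contDiffOn_endo := S.φ_smooth e he
  contDiffOn_vec := S.ξ_smooth e he
  contDiffOn_form := S.η_smooth e he
  endo_vec y hy := dParam_injective he hy <| by
    rw [dParam_endo he hy, dParam_vec he hy, S.φ_ξ, map_zero]
  endo_endo y hy x := dParam_injective he hy <| by
    rw [dParam_endo he hy, dParam_endo he hy, S.φ_sq, map_add, map_neg, map_smul,
      dParam_vec he hy, form_apply]
  form_endo y hy x := by rw [form_apply, dParam_endo he hy, S.η_φ]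
  form_vec y hy := by rw [form_apply, dParam_vec he hy, S.η_ξ]
  symm y hy x z := S.g_symm _ _ _
  nondegenerate y hy x hx := dParam_injective he hy <| by
    rw [map_zero]
    refine S.g_nondegenerate _ _ fun z => ?_
    rw [← dParam_dChart he hy z]
    exact hx _
  compat y hy x z := by
    rw [bilin_apply, dParam_endo he hy, dParam_endo he hy, S.g_compat]
    rfl

variable {S} in
lemma isSasakiLike_iff : S.IsSasakiLike ↔ ∀ e ∈ atlas (Coord (2 * n + 1)) M,
    SasakiLikeOn e.target (bilin e S.g) (endo e S.φ) (vec e S.ξ) (form e S.η) :=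
  ⟨fun h e he => ⟨S.almostContactOn he, h e he⟩, fun h e he => (h e he).sasaki⟩

lemma g_ξ (p : M) (x : TangentSpace (𝓡 (2 * n + 1)) p) : S.g p x (S.ξ p) = S.η p x := by
  have := S.g_compat p x (S.ξ p)
  rw [S.φ_ξ, S.η_ξ, map_zero] at this
  linarith

lemma g_ξ_left (p : M) (x : TangentSpace (𝓡 (2 * n + 1)) p) : S.g p (S.ξ p) x = S.η p x := by
  rw [S.g_symm, S.g_ξ]

lemma g_φ_left (p : M) (x y : TangentSpace (𝓡 (2 * n + 1)) p) :
    S.g p (S.φ p x) y = S.g p x (S.φ p y) := by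
  have := S.g_compat p x (S.φ p y)
  rw [S.φ_sq, S.η_φ, map_add, map_smul, S.g_ξ, S.η_φ, map_neg, smul_zero, mul_zero] at this
  linarith

/-- Multiplication by the complex number `r + s i` on the contact distribution, extended by the
identity on the vertical direction. -/
def complexMul (p : M) (r s : ℝ) :
    TangentSpace (𝓡 (2 * n + 1)) p →ₗ[ℝ] TangentSpace (𝓡 (2 * n + 1)) p where
  toFun x := r • (x - S.η p x • S.ξ p) + s • S.φ p x + S.η p x • S.ξ p
  map_add' x y := by
    simp only [map_add]
    module
  map_smul' t x := by
    simp only [map_smul, smul_eq_mul, RingHom.id_apply]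
    module

lemma complexMul_apply (p : M) (r s : ℝ) (x : TangentSpace (𝓡 (2 * n + 1)) p) :
    S.complexMul p r s x = r • (x - S.η p x • S.ξ p) + s • S.φ p x + S.η p x • S.ξ p := rfl

lemma complexMul_complexMul (p : M) (r s r' s' : ℝ) (x : TangentSpace (𝓡 (2 * n + 1)) p) :
    S.complexMul p r s (S.complexMul p r' s' x) =
      S.complexMul p (r * r' - s * s') (r * s' + s * r') x := by
  simp only [complexMul_apply, map_add, map_sub, map_smul, S.η_φ, S.η_ξ, S.φ_ξ, S.φ_sq,
    smul_zero]
  module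

lemma complexMul_one_zero (p : M) (x : TangentSpace (𝓡 (2 * n + 1)) p) :
    S.complexMul p 1 0 x = x := by
  rw [complexMul_apply]
  module

/-- Multiplication by a nonzero complex number as an automorphism of the tangent space. -/
def complexMulEquiv (p : M) (r s : ℝ) (h : r ^ 2 + s ^ 2 ≠ 0) :
    TangentSpace (𝓡 (2 * n + 1)) p ≃ₗ[ℝ] TangentSpace (𝓡 (2 * n + 1)) p :=
  { S.complexMul p r s with
    invFun := S.complexMul p (r / (r ^ 2 + s ^ 2)) (-s / (r ^ 2 + s ^ 2))
    left_inv := fun x => by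
      change S.complexMul p _ _ (S.complexMul p r s x) = x
      rw [complexMul_complexMul]
      convert S.complexMul_one_zero p x using 2
      congr 1 <;> field_simp <;> ring
    right_inv := fun x => by
      change S.complexMul p r s (S.complexMul p _ _ x) = x
      rw [complexMul_complexMul]
      convert S.complexMul_one_zero p x using 2
      congr 1 <;> field_simp <;> ring }

/-- On `ker η` multiplication by `r + is` is self-adjoint, so pulling `g` back by it amounts to
multiplying by `(r + is)²`. The result is the homothety metric with `a + ib = (r + is)²`. -/
lemma g_complexMul (p : M) (r s : ℝ) (x y : TangentSpace (𝓡 (2 * n + 1)) p) :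
    S.g p (S.complexMul p r s x) (S.complexMul p r s y) =
      (r ^ 2 - s ^ 2) * S.g p x y + 2 * r * s * S.g p x (S.φ p y)
        + (1 - (r ^ 2 - s ^ 2)) * (S.η p x * S.η p y) := by
  simp only [complexMul_apply, map_add, map_sub, map_smul, add_apply, sub_apply, smul_apply,
    smul_eq_mul, S.g_φ_left, S.φ_sq, S.g_ξ, S.g_ξ_left, S.η_φ, S.η_ξ, S.φ_ξ, map_neg, map_zero]
  ring

/-- The metric `a g + b g(·, φ ·) + (1 - a) η ⊗ η`. -/
def homothetyMetric (a b : ℝ) (p : M) :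
    TangentSpace (𝓡 (2 * n + 1)) p →L[ℝ] TangentSpace (𝓡 (2 * n + 1)) p →L[ℝ] ℝ :=
  a • S.g p + b • (S.g p).comp (S.φ p) + (1 - a) • (S.η p).smulRight (S.η p)

lemma homothetyMetric_apply (a b : ℝ) (p : M) (x y : TangentSpace (𝓡 (2 * n + 1)) p) :
    S.homothetyMetric a b p x y =
      a * S.g p x y + b * S.g p x (S.φ p y) + (1 - a) * (S.η p x * S.η p y) := by
  rw [← S.g_φ_left]
  rfl

lemma bilin_homothetyMetric_apply {e : OpenPartialHomeomorph M (Coord (2 * n + 1))}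
    (he : e ∈ atlas (Coord (2 * n + 1)) M) (a b : ℝ) {q : Coord (2 * n + 1)} (hq : q ∈ e.target)
    (x y : Coord (2 * n + 1)) : bilin e (S.homothetyMetric a b) q x y =
      a * bilin e S.g q x y + b * bilin e S.g q x (endo e S.φ q y)
        + (1 - a) * (form e S.η q x * form e S.η q y) := by
  rw [bilin_apply, homothetyMetric_apply, bilin_apply, bilin_apply, dParam_endo he hq]
  rfl

lemma contDiffOn_homothetyMetric {e : OpenPartialHomeomorph M (Coord (2 * n + 1))}
    (he : e ∈ atlas (Coord (2 * n + 1)) M) (a b : ℝ) :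
    ContDiffOn ℝ ∞ (bilin e (S.homothetyMetric a b)) e.target := by
  have h : ContDiffOn ℝ ∞ (fun q => a • bilin e S.g q + b • (bilin e S.g q).comp (endo e S.φ q)
      + (1 - a) • (form e S.η q).smulRight (form e S.η q)) e.target :=
    (((S.g_smooth e he).const_smul a).add
      (((S.g_smooth e he).clm_comp (S.φ_smooth e he)).const_smul b)).add
      (((S.η_smooth e he).smulRight (S.η_smooth e he)).const_smul (1 - a))
  refine h.congr fun q hq => ?_
  ext x y
  rw [S.bilin_homothetyMetric_apply he a b hq,
    ← (S.almostContactOn he).metric_endo_left hq]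
  rfl

/-- The image of `S` under the contact homothety with parameters `u`, `v` and `w = 0`. -/
def contactHomothety (u v : ℝ) : AlmostContactComplexRiemannian n M where
  φ := S.φ
  ξ := S.ξ
  η := S.η
  g := S.homothetyMetric (Real.exp (2 * u) * Real.cos (2 * v)) (Real.exp (2 * u) * Real.sin (2 * v))
  φ_smooth := S.φ_smooth
  ξ_smooth := S.ξ_smooth
  η_smooth := S.η_smooth
  g_smooth e he := S.contDiffOn_homothetyMetric he _ _
  φ_ξ := S.φ_ξ
  φ_sq := S.φ_sq
  η_φ := S.η_φ
  η_ξ := S.η_ξ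
  g_symm p x y := by
    rw [homothetyMetric_apply, homothetyMetric_apply, ← S.g_φ_left p x, S.g_symm p x y,
      S.g_symm p _ y]
    ring
  g_signature p := by
    obtain ⟨b, hb, hb1, hb2⟩ := S.g_signature p
    -- `r + is = exp (u + iv)` is a square root of `a + ib = exp (2(u + iv))`.
    set r := Real.exp u * Real.cos v with hr
    set s := Real.exp u * Real.sin v with hs
    have he : Real.exp (2 * u) = Real.exp u ^ 2 := by rw [← Real.exp_nat_mul]; norm_num
    have ha : Real.exp (2 * u) * Real.cos (2 * v) = r ^ 2 - s ^ 2 := by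
      rw [he, Real.cos_two_mul']
      ring
    have hb' : Real.exp (2 * u) * Real.sin (2 * v) = 2 * r * s := by
      rw [he, Real.sin_two_mul]
      ring
    have hrs : r ^ 2 + s ^ 2 ≠ 0 := by
      have : r ^ 2 + s ^ 2 = Real.exp u ^ 2 := by
        linear_combination Real.exp u ^ 2 * Real.sin_sq_add_cos_sq v
      rw [this]
      positivity
    -- Multiplication by `r + is` is an isometry from the new metric to `g`, so its inverse carries
    -- a pseudo-orthonormal basis to one of the same signature.
    have key : ∀ i j, S.homothetyMetric (Real.exp (2 * u) * Real.cos (2 * v))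
        (Real.exp (2 * u) * Real.sin (2 * v)) p
        (b.map (S.complexMulEquiv p r s hrs).symm i) (b.map (S.complexMulEquiv p r s hrs).symm j) =
        S.g p (b i) (b j) := fun i j => by
      rw [ha, hb', homothetyMetric_apply, ← g_complexMul, b.map_apply, b.map_apply]
      congr 1
      · congr 1
        exact (S.complexMulEquiv p r s hrs).apply_symm_apply (b i)
      · exact (S.complexMulEquiv p r s hrs).apply_symm_apply (b j)
    exact ⟨b.map (S.complexMulEquiv p r s hrs).symm,
      fun i j hij => by rw [key, hb i j hij], fun i => by rw [key, hb1], fun j => by rw [key, hb2]⟩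
  g_compat p x y := by
    simp only [homothetyMetric_apply, S.η_φ, S.g_φ_left, S.φ_sq, map_add, map_neg, map_smul,
      S.φ_ξ, S.g_ξ, map_zero, smul_eq_mul]
    ring

lemma isContactHomothetic_contactHomothety (u v : ℝ) :
    S.IsContactHomothetic (S.contactHomothety u v) := by
  refine ⟨u, v, 0, fun p => ⟨rfl, ?_, ?_, fun x y => ?_⟩⟩
  · simp [contactHomothety]
  · simp [contactHomothety]
  · rw [mul_zero, Real.exp_zero]
    exact S.homothetyMetric_apply _ _ p x y

variable {S}

lemma IsSasakiLike.contactHomothety (hS : S.IsSasakiLike) (u v : ℝ) :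
    (S.contactHomothety u v).IsSasakiLike :=
  isSasakiLike_iff.mpr fun e he => (isSasakiLike_iff.mp hS e he).sasakiLikeOn_change
    ((S.contactHomothety u v).almostContactOn he)
    fun _ hq x y => S.bilin_homothetyMetric_apply he _ _ hq x y

/-- The Ricci tensor is invariant under contact homotheties of Sasaki-like structures. -/
lemma IsSasakiLike.ric_contactHomothety (hS : S.IsSasakiLike) (u v : ℝ)
    {e : OpenPartialHomeomorph M (Coord (2 * n + 1))} (he : e ∈ atlas (Coord (2 * n + 1)) M)
    {q : Coord (2 * n + 1)} (hq : q ∈ e.target) (x y : Coord (2 * n + 1)) :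
    (S.contactHomothety u v).Ric e q x y = S.Ric e q x y :=
  (isSasakiLike_iff.mp hS e he).ricci_change hq ((S.contactHomothety u v).almostContactOn he)
    (fun _ hq x y => S.bilin_homothetyMetric_apply he _ _ hq x y) x y

/-! ### Choice of the parameters and conclusion -/

/-- Every nonzero complex number has the form `exp (2 (u + i v))`; here for `1 / (c + i d)`. -/
lemma exists_exp_mul_cos_sin {c d : ℝ} (h : c ^ 2 + d ^ 2 ≠ 0) : ∃ u v : ℝ,
    Real.exp (2 * u) * Real.cos (2 * v) = c / (c ^ 2 + d ^ 2) ∧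
    Real.exp (2 * u) * Real.sin (2 * v) = -d / (c ^ 2 + d ^ 2) := by
  have hz : (⟨c, d⟩ : ℂ)⁻¹ ≠ 0 := inv_ne_zero fun h0 => h (by
    have h1 := congrArg Complex.re h0
    have h2 := congrArg Complex.im h0
    simp only [Complex.zero_re, Complex.zero_im] at h1 h2
    rw [h1, h2]
    ring)
  have hexp := Complex.exp_log hz
  set L := Complex.log (⟨c, d⟩ : ℂ)⁻¹
  have hn : Complex.normSq ⟨c, d⟩ = c ^ 2 + d ^ 2 := by rw [Complex.normSq_mk]; ring
  refine ⟨L.re / 2, L.im / 2, ?_, ?_⟩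
  · rw [mul_div_cancel₀ _ two_ne_zero, mul_div_cancel₀ _ two_ne_zero, ← Complex.exp_re, hexp,
      Complex.inv_re, hn]
  · rw [mul_div_cancel₀ _ two_ne_zero, mul_div_cancel₀ _ two_ne_zero, ← Complex.exp_im, hexp,
      Complex.inv_im, hn]

/-- The transformation depends only on `c` and `d`, not on the point, and Ricci invariance is
pointwise; hence one structure serves all points where the condition holds. -/
lemma IsSasakiLike.exists_contactHomothetic (hS : S.IsSasakiLike) {c d : ℝ}
    (hcd : c ^ 2 + d ^ 2 ≠ 0) :
    ∃ S' : AlmostContactComplexRiemannian n M,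
      S.IsContactHomothetic S' ∧ S'.IsSasakiLike ∧
      ∀ e ∈ atlas (Coord (2 * n + 1)) M, ∀ q ∈ e.target,
        S.HasEtaComplexEinsteinForm c d e q →
          ∀ x y, S'.Ric e q x y = 2 * (n : ℝ) * bilin e S'.g q x y := by
  obtain ⟨u, v, ha, hb⟩ := exists_exp_mul_cos_sin hcd
  refine ⟨S.contactHomothety u v, S.isContactHomothetic_contactHomothety u v,
    hS.contactHomothety u v, fun e he q hq h x y => ?_⟩
  rw [hS.ric_contactHomothety u v he hq, h x y]
  change _ = _ * bilin e (S.homothetyMetric _ _) q x y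
  rw [S.bilin_homothetyMetric_apply he _ _ hq, ha, hb]
  field_simp
  ring

end AlmostContactComplexRiemannian

end

theorem proposition5p4 (n : ℕ) (M : Type*) [TopologicalSpace M]
    [ChartedSpace (EuclideanSpace ℝ (Fin (2 * n + 1))) M]
    [IsManifold (𝓡 (2 * n + 1)) ∞ M]
    (S : AlmostContactComplexRiemannian n M) (hS : S.IsSasakiLike) :
    (S.IsEtaComplexEinstein →
      ∃ S' : AlmostContactComplexRiemannian n M,
        S.IsContactHomothetic S' ∧ S'.IsSasakiLike ∧ S'.IsEinstein) ∧
    (∀ c d : ℝ, c ^ 2 + d ^ 2 ≠ 0 →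
      ∃ S' : AlmostContactComplexRiemannian n M,
        S.IsContactHomothetic S' ∧ S'.IsSasakiLike ∧
        ∀ e ∈ atlas (EuclideanSpace ℝ (Fin (2 * n + 1))) M, ∀ q ∈ e.target,
          S.HasEtaComplexEinsteinForm c d e q →
            ∀ x y, S'.Ric e q x y = 2 * (n : ℝ) * ChartExpr.bilin e S'.g q x y) := by
  refine ⟨?_, fun c d hcd => hS.exists_contactHomothetic hcd⟩
  rintro ⟨c, d, hcd, h⟩
  obtain ⟨S', h1, h2, h3⟩ := hS.exists_contactHomothetic hcd
  exact ⟨S', h1, h2, 2 * n, fun e he q hq => h3 e he q hq (h e he q hq)⟩
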